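/- Let $X$ be a (real) Banach lattice. A sequence $(s_n)$ in $X$ *converges uniformly* to $v\in X$ if there is $e\in X_+$ such that for every $\varepsilon>0$ there is $n_0$ with $|s_n-v|\le\varepsilon e$ for all $n\ge n_0$. A sequence $(x_k)_{k\ge1}$ in $X$ is *bibasic* if it is a Schauder basic sequence, i.e. every $x$ in its closed linear span $[x_k]$ has a unique norm convergent expansion $x=\sum_{k=1}^\infty\alpha_kx_k$ with real coefficients, and if moreover, whenever a series $\sum_{k=1}^\infty\alpha_kx_k$ converges in norm, its partial sums also converge uniformly to its norm sum. A sequence $(X_k)_{k\ge1}$ of closed non-zero subspaces of $X$ is a *Schauder decomposition* (of the closed linear span $[X_k]$ of $\bigcup_kX_k$) if every $x\in[X_k]$ has a unique norm convergent expansion $x=\sum_{k=1}^\infty x_k$ with $x_k\in X_k$ for all $k$; it is a *bidecomposition* if, moreover, the partial sums of this expansion converge uniformly to $x$, for every $x\in[X_k]$. **Theorem.** Let $(X_k)_{k\ge1}$ be a sequence of closed non-zero subspaces of a Banach lattice $X$. Suppose that every sequence $(x_k)$ satisfying $0\ne x_k\in X_k$ for all $k$ is bibasic. Then there exists $N\in\mathbb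 N$ such that the sequence $(X_k)_{k\ge N}$ is a bidecomposition. Moreover, if $(X_k)_{k\ge1}$ is a Schauder decomposition, or if $\dim X_k<\infty$ for every $k$, then one may choose $N=1$. -/

import Mathlib

open Filter Topology

/-- A sequence `(s n)` in a vector lattice converges uniformly (that is, relatively uniformly,
with respect to some regulator `e ≥ 0`) to `v`. -/
def ConvergesUniformlyTo {X : Type*} [AddCommGroup X] [Lattice X] [Module ℝ X]
    (s : ℕ → X) (v : X) : Prop :=
  ∃ e : X, 0 ≤ e ∧ ∀ ε : ℝ, 0 < ε → ∃ n₀ : ℕ, ∀ n, n₀ ≤ n → |s n - v| ≤ ε • e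

/-- `(x k)` is a Schauder basic sequence: every vector of its closed linear span has a unique
norm convergent expansion `∑ α k • x k` (convergence of the sequence of partial sums). -/
def IsSchauderBasic {X : Type*} [NormedAddCommGroup X] [NormedSpace ℝ X] (x : ℕ → X) : Prop :=
  ∀ v ∈ (Submodule.span ℝ (Set.range x)).topologicalClosure,
    ∃! α : ℕ → ℝ, Tendsto (fun n => ∑ k ∈ Finset.range n, α k • x k) atTop (𝓝 v)

/-- `(x k)` is a bibasic sequence in the normed lattice `X`: it is Schauder basic and every norm
convergent series `∑ α k • x k` also converges uniformly to its norm sum. -/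
def IsBibasic {X : Type*} [NormedAddCommGroup X] [Lattice X] [NormedSpace ℝ X]
    (x : ℕ → X) : Prop :=
  IsSchauderBasic x ∧
    ∀ (α : ℕ → ℝ) (v : X),
      Tendsto (fun n => ∑ k ∈ Finset.range n, α k • x k) atTop (𝓝 v) →
        ConvergesUniformlyTo (fun n => ∑ k ∈ Finset.range n, α k • x k) v

/-- The sequence `(Y k)` of closed non-zero subspaces is a Schauder decomposition of the closed
linear span of its union: every vector `v` there has a unique norm convergent expansion
`∑ y k` with `y k ∈ Y k`. -/
def IsSchauderDecomposition {X : Type*} [NormedAddCommGroup X] [NormedSpace ℝ X]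
    (Y : ℕ → Submodule ℝ X) : Prop :=
  (∀ k, IsClosed (Y k : Set X) ∧ Y k ≠ ⊥) ∧
    ∀ v ∈ (⨆ k, Y k).topologicalClosure,
      ∃! y : ℕ → X, (∀ k, y k ∈ Y k) ∧
        Tendsto (fun n => ∑ k ∈ Finset.range n, y k) atTop (𝓝 v)

/-- `(Y k)` is a bidecomposition in the normed lattice `X`: it is a Schauder decomposition and
the norm expansion of each vector also converges uniformly to that vector. -/
def IsBidecomposition {X : Type*} [NormedAddCommGroup X] [Lattice X] [NormedSpace ℝ X]
    (Y : ℕ → Submodule ℝ X) : Prop :=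
  IsSchauderDecomposition Y ∧
    ∀ (y : ℕ → X) (v : X), (∀ k, y k ∈ Y k) →
      Tendsto (fun n => ∑ k ∈ Finset.range n, y k) atTop (𝓝 v) →
        ConvergesUniformlyTo (fun n => ∑ k ∈ Finset.range n, y k) v

/-! The heart is a gliding hump. If no tail had uniformly bounded partial sum projections, then from
any starting index there would be a finite block violating any prescribed bound. Concatenating such
blocks gives one selection whose basis constant is infinite, although a basic sequence has a finite
one (`exists_tail_norm_sum_range_le`). On a tail with bounded projections, the sum map from
convergent series is bounded below, so its range is closed and fills the closed span.

Uniqueness and uniform convergence concern one expansion at a time, so they come directly from a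
bibasic selection. Only existence needs the tail. For the whole sequence, existence is either
assumed or, in finite dimensions, follows because a closed subspace plus a finite-dimensional one is
closed. -/

theorem sum_range_prefix_add {M : Type*} [AddCommMonoid M] (N n : ℕ) (f z : ℕ → M) :
    (∑ k ∈ Finset.range (N + n), if k < N then f k else z (k - N)) =
      ∑ k ∈ Finset.range N, f k + ∑ k ∈ Finset.range n, z k := by
  rw [Finset.sum_range_add]
  congr 1
  · exact Finset.sum_congr rfl fun k hk => if_pos (Finset.mem_range.1 hk)
  · exact Finset.sum_congr rfl fun k _ => by simp

/-- Prefixing a convergent series with finitely many terms. -/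
theorem tendsto_sum_range_prefix {X : Type*} [NormedAddCommGroup X] (N : ℕ) (f z : ℕ → X)
    {v : X}
    (hz : Tendsto (fun n => ∑ k ∈ Finset.range n, z k) atTop (𝓝 v)) :
    Tendsto (fun n => ∑ k ∈ Finset.range n, if k < N then f k else z (k - N)) atTop
      (𝓝 (∑ k ∈ Finset.range N, f k + v)) := by
  rw [← tendsto_add_atTop_iff_nat N]
  refine (hz.const_add (∑ k ∈ Finset.range N, f k)).congr fun n => ?_
  rw [add_comm n N, sum_range_prefix_add]

theorem norm_le_of_forall_norm_coe_le {X : Type*} [NormedAddCommGroup X]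
    {w : C(OnePoint ℕ, X)} {C : ℝ}
    (h : ∀ n : ℕ, ‖w (n : OnePoint ℕ)‖ ≤ C) : ‖w‖ ≤ C := by
  have hlim : ‖w OnePoint.infty‖ ≤ C :=
    le_of_tendsto' ((OnePoint.continuous_iff_from_nat _).1 w.continuous).norm h
  refine (ContinuousMap.norm_le_of_nonempty w).2 fun p => ?_
  induction p using OnePoint.rec with
  | infty => exact hlim
  | coe n => exact h n

/-! ### The Banach space of convergent series and bounds on partial sums. -/

section PartialSums

variable {X : Type*} [NormedAddCommGroup X] [NormedSpace ℝ X]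

/-- The sequences of partial sums of convergent series `∑ y k` with `y k ∈ Y k`, each extended by
its limit to the one point compactification of `ℕ`. -/
noncomputable def convergentPartialSums (Y : ℕ → Submodule ℝ X) :
    Submodule ℝ C(OnePoint ℕ, X) :=
  (⊥ : Submodule ℝ X).comap (ContinuousMap.evalCLM ℝ ((0 : ℕ) : OnePoint ℕ)).toLinearMap ⊓
    ⨅ k : ℕ, (Y k).comap (ContinuousMap.evalCLM ℝ ((k + 1 : ℕ) : OnePoint ℕ) -
      ContinuousMap.evalCLM ℝ (k : OnePoint ℕ) : C(OnePoint ℕ, X) →L[ℝ] X).toLinearMap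

theorem mem_convergentPartialSums {Y : ℕ → Submodule ℝ X} {w : C(OnePoint ℕ, X)} :
    w ∈ convergentPartialSums Y ↔
      w ((0 : ℕ) : OnePoint ℕ) = 0 ∧
        ∀ k : ℕ, w ((k + 1 : ℕ) : OnePoint ℕ) - w (k : OnePoint ℕ) ∈ Y k := by
  simp [convergentPartialSums, Submodule.mem_iInf]

theorem isClosed_convergentPartialSums {Y : ℕ → Submodule ℝ X}
    (hY : ∀ k, IsClosed (Y k : Set X)) :
    IsClosed (convergentPartialSums Y : Set C(OnePoint ℕ, X)) := by
  have : (convergentPartialSums Y : Set C(OnePoint ℕ, X)) =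
      {w | w ((0 : ℕ) : OnePoint ℕ) = 0} ∩
        ⋂ k : ℕ, {w | w ((k + 1 : ℕ) : OnePoint ℕ) - w (k : OnePoint ℕ) ∈ Y k} := by
    ext w
    simp only [SetLike.mem_coe, mem_convergentPartialSums, Set.mem_inter_iff, Set.mem_ofPred_eq,
      Set.mem_iInter]
  rw [this]
  refine (isClosed_eq (by fun_prop) continuous_const).inter (isClosed_iInter fun k => ?_)
  exact (hY k).preimage (by fun_prop)

/-- The sum of the series, as a continuous linear map on `convergentPartialSums Y`. -/
noncomputable def seriesSum (Y : ℕ → Submodule ℝ X) : convergentPartialSums Y →L[ℝ] X :=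
  (ContinuousMap.evalCLM ℝ (OnePoint.infty : OnePoint ℕ)).comp (convergentPartialSums Y).subtypeL

theorem seriesSum_apply {Y : ℕ → Submodule ℝ X} (w : convergentPartialSums Y) :
    seriesSum Y w = w.1 OnePoint.infty := rfl

theorem exists_convergentPartialSums {Y : ℕ → Submodule ℝ X} {y : ℕ → X} {v : X}
    (hy : ∀ k, y k ∈ Y k)
    (hv : Tendsto (fun n => ∑ k ∈ Finset.range n, y k) atTop (𝓝 v)) :
    ∃ w : convergentPartialSums Y, seriesSum Y w = v ∧
      ∀ n : ℕ, w.1 (n : OnePoint ℕ) = ∑ k ∈ Finset.range n, y k := by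
  refine ⟨⟨OnePoint.continuousMapMkNat _ v hv, mem_convergentPartialSums.2 ⟨?_, fun k => ?_⟩⟩,
    rfl, fun n => rfl⟩
  · exact Finset.sum_range_zero y
  · change ∑ i ∈ Finset.range (k + 1), y i - ∑ i ∈ Finset.range k, y i ∈ Y k
    rw [Finset.sum_range_succ, add_sub_cancel_left]
    exact hy k

theorem tendsto_convergentPartialSums {Y : ℕ → Submodule ℝ X} (w : convergentPartialSums Y) :
    Tendsto (fun n : ℕ => w.1 (n : OnePoint ℕ)) atTop (𝓝 (seriesSum Y w)) :=
  (OnePoint.continuous_iff_from_nat _).1 w.1.continuous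

theorem sum_range_increments {Y : ℕ → Submodule ℝ X} (w : convergentPartialSums Y) (n : ℕ) :
    ∑ k ∈ Finset.range n, (w.1 ((k + 1 : ℕ) : OnePoint ℕ) - w.1 (k : OnePoint ℕ)) =
      w.1 (n : OnePoint ℕ) := by
  rw [Finset.sum_range_sub (fun k : ℕ => w.1 (k : OnePoint ℕ)),
    (mem_convergentPartialSums.1 w.2).1, sub_zero]

theorem mem_range_seriesSum {Y : ℕ → Submodule ℝ X} {v : X} :
    v ∈ Set.range (seriesSum Y) ↔
      ∃ y : ℕ → X, (∀ k, y k ∈ Y k) ∧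
        Tendsto (fun n => ∑ k ∈ Finset.range n, y k) atTop (𝓝 v) := by
  constructor
  · rintro ⟨w, rfl⟩
    refine ⟨fun k => w.1 ((k + 1 : ℕ) : OnePoint ℕ) - w.1 (k : OnePoint ℕ),
      (mem_convergentPartialSums.1 w.2).2, ?_⟩
    simpa only [sum_range_increments] using tendsto_convergentPartialSums w
  · rintro ⟨y, hy, hv⟩
    obtain ⟨w, hw, -⟩ := exists_convergentPartialSums hy hv
    exact ⟨w, hw⟩

theorem iSup_le_range_seriesSum (Y : ℕ → Submodule ℝ X) :
    ⨆ k, Y k ≤ LinearMap.range (seriesSum Y).toLinearMap := by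
  refine iSup_le fun k v hv => ?_
  refine mem_range_seriesSum.2 ⟨Pi.single k v, fun i => ?_, ?_⟩
  · rcases eq_or_ne i k with rfl | h
    · simpa using hv
    · simp [h]
  · refine tendsto_const_nhds.congr' ?_
    filter_upwards [eventually_gt_atTop k] with n hn
    simp [hn]

/-- A Schauder basic sequence has a finite basis constant. -/
theorem IsSchauderBasic.exists_norm_sum_range_le [CompleteSpace X] {x : ℕ → X}
    (hx : IsSchauderBasic x) :
    ∃ K : ℝ, 0 ≤ K ∧ ∀ (α : ℕ → ℝ) (m n : ℕ), m ≤ n →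
      ‖∑ k ∈ Finset.range m, α k • x k‖ ≤ K * ‖∑ k ∈ Finset.range n, α k • x k‖ := by
  set Y : ℕ → Submodule ℝ X := fun k => ℝ ∙ x k with hYdef
  have hYcl : ∀ k, IsClosed (Y k : Set X) := fun k => Submodule.closed_of_finiteDimensional _
  have : CompleteSpace (convergentPartialSums Y) :=
    (isClosed_convergentPartialSums hYcl).completeSpace_coe
  have hcoef : ∀ y : ℕ → X, (∀ k, y k ∈ Y k) → ∃ α : ℕ → ℝ, ∀ k, α k • x k = y k := fun y hy =>
    ⟨fun k => (Submodule.mem_span_singleton.1 (hy k)).choose,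
      fun k => (Submodule.mem_span_singleton.1 (hy k)).choose_spec⟩
  have hinj : Function.Injective (seriesSum Y) := by
    refine (injective_iff_map_eq_zero _).2 fun w hw => ?_
    obtain ⟨α, hα⟩ := hcoef _ (mem_convergentPartialSums.1 w.2).2
    have hα0 : α = 0 := by
      refine (hx 0 (Submodule.zero_mem _)).unique ?_ ?_
      · simpa only [hα, sum_range_increments, hw] using tendsto_convergentPartialSums w
      · simp
    have hn : ∀ n : ℕ, w.1 (n : OnePoint ℕ) = 0 := fun n => by
      rw [← sum_range_increments]
      exact Finset.sum_eq_zero fun k _ => by rw [← hα k, hα0]; simp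
    have h0 : ‖w.1‖ ≤ 0 := norm_le_of_forall_norm_coe_le fun n => by rw [hn n, norm_zero]
    exact Subtype.ext (norm_le_zero_iff.1 h0)
  have hrange : Set.range (seriesSum Y) =
      ((Submodule.span ℝ (Set.range x)).topologicalClosure : Set X) := by
    ext v
    constructor
    · intro hv
      obtain ⟨y, hy, hv⟩ := mem_range_seriesSum.1 hv
      refine mem_closure_of_tendsto hv (Eventually.of_forall fun n => ?_)
      refine Submodule.sum_mem _ fun k _ => ?_
      exact Submodule.span_mono (Set.singleton_subset_iff.2 (Set.mem_range_self k)) (hy k)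
    · intro hv
      obtain ⟨α, hα, -⟩ := hx v hv
      exact mem_range_seriesSum.2
        ⟨_, fun k => Submodule.smul_mem _ _ (Submodule.mem_span_singleton_self _), hα⟩
  -- Open mapping theorem: the inverse of the sum map is bounded, and its bound is the basis
  -- constant.
  obtain ⟨K, hK⟩ := (seriesSum Y).antilipschitz_of_injective_of_isClosed_range hinj
    (by rw [hrange]; exact Submodule.isClosed_topologicalClosure _)
  refine ⟨K, K.2, fun α m n hmn => ?_⟩
  -- Truncating at `n` makes the finite sum the limit of a series, whose sup norm dominates every
  -- earlier partial sum.
  set β : ℕ → ℝ := fun k => if k < n then α k else 0 with hβ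
  have hβsum : ∀ i ≤ n, ∑ k ∈ Finset.range i, β k • x k = ∑ k ∈ Finset.range i, α k • x k :=
    fun i hi => Finset.sum_congr rfl fun k hk => by
      simp only [hβ, if_pos ((Finset.mem_range.1 hk).trans_le hi)]
  have hlim : Tendsto (fun i => ∑ k ∈ Finset.range i, β k • x k) atTop
      (𝓝 (∑ k ∈ Finset.range n, α k • x k)) := by
    refine tendsto_const_nhds.congr' ?_
    filter_upwards [eventually_ge_atTop n] with i hi
    rw [← hβsum n le_rfl]
    refine Finset.sum_subset (Finset.range_mono hi) fun k _ hk => ?_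
    simp only [hβ, if_neg (fun h => hk (Finset.mem_range.2 h)), zero_smul]
  obtain ⟨w, hw, hwn⟩ := exists_convergentPartialSums (Y := Y)
    (fun k => Submodule.smul_mem _ _ (Submodule.mem_span_singleton_self _)) hlim
  calc ‖∑ k ∈ Finset.range m, α k • x k‖ = ‖w.1 (m : OnePoint ℕ)‖ := by rw [hwn, hβsum m hmn]
    _ ≤ ‖w.1‖ := w.1.norm_coe_le_norm _
    _ ≤ K * ‖seriesSum Y w‖ := (ZeroHomClass.bound_of_antilipschitz _ hK w)
    _ = K * ‖∑ k ∈ Finset.range n, α k • x k‖ := by rw [hw]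

/-- Closed subspaces whose partial sum projections are uniformly bounded: every vector of the
closed linear span has an expansion. -/
theorem exists_expansion_of_norm_sum_range_le [CompleteSpace X] {Y : ℕ → Submodule ℝ X}
    (hY : ∀ k, IsClosed (Y k : Set X)) {K : ℝ} (hK : 0 ≤ K)
    (hbound : ∀ y : ℕ → X, (∀ k, y k ∈ Y k) → ∀ m n : ℕ, m ≤ n →
      ‖∑ k ∈ Finset.range m, y k‖ ≤ K * ‖∑ k ∈ Finset.range n, y k‖)
    {v : X} (hv : v ∈ (⨆ k, Y k).topologicalClosure) :
    ∃ y : ℕ → X, (∀ k, y k ∈ Y k) ∧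
      Tendsto (fun n => ∑ k ∈ Finset.range n, y k) atTop (𝓝 v) := by
  have : CompleteSpace (convergentPartialSums Y) :=
    (isClosed_convergentPartialSums hY).completeSpace_coe
  have hanti : AntilipschitzWith ⟨K, hK⟩ (seriesSum Y) := by
    refine AddMonoidHomClass.antilipschitz_of_bound _ fun w => ?_
    refine norm_le_of_forall_norm_coe_le fun m => ?_
    change ‖w.1 (m : OnePoint ℕ)‖ ≤ K * ‖seriesSum Y w‖
    refine ge_of_tendsto ((tendsto_convergentPartialSums w).norm.const_mul K) ?_
    filter_upwards [eventually_ge_atTop m] with n hn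
    simpa only [sum_range_increments] using
      hbound _ (mem_convergentPartialSums.1 w.2).2 m n hn
  refine mem_range_seriesSum.1 ?_
  have hcl : IsClosed (LinearMap.range (seriesSum Y).toLinearMap : Set X) :=
    hanti.isClosed_range (seriesSum Y).uniformContinuous
  exact Submodule.topologicalClosure_minimal _ (iSup_le_range_seriesSum Y) hcl hv

/-- Zero entries are replaced by arbitrary non-zero vectors with coefficient `0`, so the hypothesis
on non-zero selections applies to any `y`. -/
theorem exists_smul_eq_of_forall_mem {Y : ℕ → Submodule ℝ X} (hne : ∀ k, Y k ≠ ⊥) {y : ℕ → X}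
    (hy : ∀ k, y k ∈ Y k) :
    ∃ (x : ℕ → X) (α : ℕ → ℝ), (∀ k, x k ∈ Y k ∧ x k ≠ 0) ∧ ∀ k, α k • x k = y k := by
  choose e heY he0 using fun k => (Submodule.ne_bot_iff _).1 (hne k)
  classical
  refine ⟨fun k => if y k = 0 then e k else y k, fun k => if y k = 0 then 0 else 1,
    fun k => ?_, fun k => ?_⟩
  · by_cases h : y k = 0
    · simpa [h] using ⟨heY k, he0 k⟩
    · simpa [h] using hy k
  · by_cases h : y k = 0 <;> simp [h]

/-- If every selection of non-zero vectors is Schauder basic, then the partial sum projections of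
some tail are uniformly bounded. -/
theorem exists_tail_norm_sum_range_le [CompleteSpace X] {Y : ℕ → Submodule ℝ X}
    (hne : ∀ k, Y k ≠ ⊥)
    (hbasic : ∀ x : ℕ → X, (∀ k, x k ∈ Y k ∧ x k ≠ 0) → IsSchauderBasic x) :
    ∃ (N : ℕ) (K : ℝ), 0 ≤ K ∧ ∀ y : ℕ → X, (∀ k, y k ∈ Y (N + k)) → ∀ m n : ℕ, m ≤ n →
      ‖∑ k ∈ Finset.range m, y k‖ ≤ K * ‖∑ k ∈ Finset.range n, y k‖ := by
  by_contra! hcon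
  have hbad : ∀ N j : ℕ, ∃ (y : ℕ → X) (m n : ℕ), (∀ k, y k ∈ Y (N + k)) ∧ m ≤ n ∧
      (j : ℝ) * ‖∑ k ∈ Finset.range n, y k‖ < ‖∑ k ∈ Finset.range m, y k‖ := fun N j => by
    obtain ⟨y, hy, m, n, hmn, h⟩ := hcon N j j.cast_nonneg
    exact ⟨y, m, n, hy, hmn, h⟩
  choose y m n hy hmn hlt using hbad
  have hnpos : ∀ N j, 0 < n N j := fun N j => by
    by_contra! h0
    have hn0 : n N j = 0 := by omega
    have hm0 : m N j = 0 := by have := hmn N j; omega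
    have := hlt N j
    simp [hn0, hm0] at this
  -- The `j`-th block of the concatenated sequence starts at `b j`.
  let b : ℕ → ℕ := fun j => Nat.rec (motive := fun _ => ℕ) 0 (fun j N => N + n N j) j
  have hb : ∀ j, b (j + 1) = b j + n (b j) j := fun j => rfl
  have hbmono : StrictMono b := strictMono_nat_of_lt_succ fun j => by
    rw [hb]; exact Nat.lt_add_of_pos_right (hnpos _ _)
  have hex : ∀ i, ∃ j, i < b (j + 1) := fun i => ⟨i, hbmono.id_le (i + 1)⟩
  have hfind : ∀ j i, b j ≤ i → i < b (j + 1) → Nat.find (hex i) = j := fun j i h1 h2 =>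
    (Nat.find_eq_iff _).2 ⟨h2, fun l hl => not_lt.2 ((hbmono.monotone hl).trans h1)⟩
  have hfind_le : ∀ i, b (Nat.find (hex i)) ≤ i := fun i => by
    rcases h : Nat.find (hex i) with _ | l
    · exact Nat.zero_le _
    · exact not_lt.1 (Nat.find_min (hex i) (m := l) (by omega))
  -- `Nat.find (hex i)` is the block containing `i`; block `j` violates the bound with constant `j`.
  let z : ℕ → X := fun i =>
    y (b (Nat.find (hex i))) (Nat.find (hex i)) (i - b (Nat.find (hex i)))
  have hzY : ∀ i, z i ∈ Y i := fun i => by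
    have := hy (b (Nat.find (hex i))) (Nat.find (hex i)) (i - b (Nat.find (hex i)))
    rwa [Nat.add_sub_cancel' (hfind_le i)] at this
  have hz : ∀ j k, k < n (b j) j → z (b j + k) = y (b j) j k := fun j k hk => by
    have := hfind j (b j + k) (Nat.le_add_right _ _) (by rw [hb]; omega)
    simp only [z, this, Nat.add_sub_cancel_left]
  obtain ⟨x, α, hx, hα⟩ := exists_smul_eq_of_forall_mem hne hzY
  obtain ⟨K, -, hK⟩ := (hbasic x hx).exists_norm_sum_range_le
  obtain ⟨j, hj⟩ := exists_nat_ge K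
  -- Erasing all terms before block `j` isolates its partial sums, which contradict `K ≤ j`.
  let β : ℕ → ℝ := fun i => if b j ≤ i then α i else 0
  have hsum : ∀ l ≤ n (b j) j, ∑ i ∈ Finset.range (b j + l), β i • x i =
      ∑ k ∈ Finset.range l, y (b j) j k := fun l hl => by
    have hbefore : ∀ i ∈ Finset.range (b j), β i • x i = 0 := fun i hi => by
      simp [β, (Finset.mem_range.1 hi).not_ge]
    rw [Finset.sum_range_add, Finset.sum_eq_zero hbefore, zero_add]
    refine Finset.sum_congr rfl fun k hk => ?_
    rw [← hz j k ((Finset.mem_range.1 hk).trans_le hl), ← hα]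
    simp only [β, if_pos (Nat.le_add_right _ _)]
  have hle := hK β _ _ (Nat.add_le_add_left (hmn (b j) j) (b j))
  rw [hsum _ (hmn _ _), hsum _ le_rfl] at hle
  have := hlt (b j) j
  have := mul_le_mul_of_nonneg_right hj (norm_nonneg (∑ k ∈ Finset.range (n (b j) j), y (b j) j k))
  linarith

end PartialSums

/-! ### From existence of expansions to bidecompositions. -/

section Bidecomposition

variable {X : Type*} [NormedAddCommGroup X] [NormedSpace ℝ X]

theorem eq_zero_of_tendsto_sum_range_zero {Y : ℕ → Submodule ℝ X} (hne : ∀ k, Y k ≠ ⊥)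
    (hbasic : ∀ x : ℕ → X, (∀ k, x k ∈ Y k ∧ x k ≠ 0) → IsSchauderBasic x) {y : ℕ → X}
    (hy : ∀ k, y k ∈ Y k)
    (h0 : Tendsto (fun n => ∑ k ∈ Finset.range n, y k) atTop (𝓝 0)) (k : ℕ) : y k = 0 := by
  obtain ⟨x, α, hx, hα⟩ := exists_smul_eq_of_forall_mem hne hy
  have : α = 0 := (hbasic x hx 0 (Submodule.zero_mem _)).unique
    (by simpa only [hα] using h0) (by simp)
  rw [← hα, this, Pi.zero_apply, zero_smul]

theorem eq_of_tendsto_sum_range {Y : ℕ → Submodule ℝ X} (hne : ∀ k, Y k ≠ ⊥)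
    (hbasic : ∀ x : ℕ → X, (∀ k, x k ∈ Y k ∧ x k ≠ 0) → IsSchauderBasic x) {y y' : ℕ → X} {v : X}
    (hy : ∀ k, y k ∈ Y k) (hy' : ∀ k, y' k ∈ Y k)
    (h : Tendsto (fun n => ∑ k ∈ Finset.range n, y k) atTop (𝓝 v))
    (h' : Tendsto (fun n => ∑ k ∈ Finset.range n, y' k) atTop (𝓝 v)) : y = y' := by
  funext k
  refine sub_eq_zero.1 (eq_zero_of_tendsto_sum_range_zero hne hbasic (y := fun k => y k - y' k)
    (fun k => Submodule.sub_mem _ (hy k) (hy' k)) ?_ k)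
  simpa only [Finset.sum_sub_distrib, sub_self] using h.sub h'

theorem convergesUniformlyTo_of_tendsto [Lattice X] {Y : ℕ → Submodule ℝ X} (hne : ∀ k, Y k ≠ ⊥)
    (hbib : ∀ x : ℕ → X, (∀ k, x k ∈ Y k ∧ x k ≠ 0) → IsBibasic x) {y : ℕ → X} {v : X}
    (hy : ∀ k, y k ∈ Y k)
    (hv : Tendsto (fun n => ∑ k ∈ Finset.range n, y k) atTop (𝓝 v)) :
    ConvergesUniformlyTo (fun n => ∑ k ∈ Finset.range n, y k) v := by
  obtain ⟨x, α, hx, hα⟩ := exists_smul_eq_of_forall_mem hne hy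
  simpa only [hα] using (hbib x hx).2 α v (by simpa only [hα] using hv)

theorem isBidecomposition_of_exists_expansion [Lattice X] {Y : ℕ → Submodule ℝ X}
    (hclosed : ∀ k, IsClosed (Y k : Set X)) (hne : ∀ k, Y k ≠ ⊥)
    (hbib : ∀ x : ℕ → X, (∀ k, x k ∈ Y k ∧ x k ≠ 0) → IsBibasic x)
    (hex : ∀ v ∈ (⨆ k, Y k).topologicalClosure, ∃ y : ℕ → X, (∀ k, y k ∈ Y k) ∧
      Tendsto (fun n => ∑ k ∈ Finset.range n, y k) atTop (𝓝 v)) :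
    IsBidecomposition Y := by
  refine ⟨⟨fun k => ⟨hclosed k, hne k⟩, fun v hv => ?_⟩,
    fun y v hy hv => convergesUniformlyTo_of_tendsto hne hbib hy hv⟩
  obtain ⟨y, hy, hyv⟩ := hex v hv
  exact ⟨y, ⟨hy, hyv⟩, fun y' hy' =>
    eq_of_tendsto_sum_range hne (fun x hx => (hbib x hx).1) hy'.1 hy hy'.2 hyv⟩

theorem prefix_mem {Y : ℕ → Submodule ℝ X} {N : ℕ} {f z : ℕ → X} (hf : ∀ k < N, f k ∈ Y k)
    (hz : ∀ k, z k ∈ Y (N + k)) (k : ℕ) : (if k < N then f k else z (k - N)) ∈ Y k := by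
  split_ifs with h
  · exact hf k h
  · simpa only [Nat.add_sub_cancel' (not_lt.1 h)] using hz (k - N)

/-- A tail all of whose vectors have expansions is a bidecomposition. -/
theorem IsBidecomposition.of_tail_expansion [Lattice X] {Y : ℕ → Submodule ℝ X}
    (hclosed : ∀ k, IsClosed (Y k : Set X)) (hne : ∀ k, Y k ≠ ⊥)
    (hbib : ∀ x : ℕ → X, (∀ k, x k ∈ Y k ∧ x k ≠ 0) → IsBibasic x) {N : ℕ}
    (hex : ∀ v ∈ (⨆ k, Y (N + k)).topologicalClosure, ∃ y : ℕ → X, (∀ k, y k ∈ Y (N + k)) ∧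
      Tendsto (fun n => ∑ k ∈ Finset.range n, y k) atTop (𝓝 v)) :
    IsBidecomposition fun k => Y (N + k) := by
  -- Padding with `N` zeros turns a tail expansion into one along `Y`, where the hypothesis on
  -- selections applies.
  have hpre : ∀ {y : ℕ → X} {v : X},
      Tendsto (fun n => ∑ k ∈ Finset.range n, y k) atTop (𝓝 v) →
      Tendsto (fun n => ∑ k ∈ Finset.range n, if k < N then 0 else y (k - N)) atTop (𝓝 v) :=
    fun {y v} hv => by simpa using tendsto_sum_range_prefix N (fun _ => (0 : X)) y hv
  have hmem : ∀ {y : ℕ → X}, (∀ k, y k ∈ Y (N + k)) →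
      ∀ k, (if k < N then 0 else y (k - N)) ∈ Y k :=
    fun {y} hy => prefix_mem (f := fun _ => 0) (fun k _ => Submodule.zero_mem _) hy
  refine ⟨⟨fun k => ⟨hclosed _, hne _⟩, fun v hv => ?_⟩, fun y v hy hv => ?_⟩
  · obtain ⟨y, hy, hyv⟩ := hex v hv
    refine ⟨y, ⟨hy, hyv⟩, fun y' ⟨hy', hyv'⟩ => funext fun k => ?_⟩
    have := congrFun (eq_of_tendsto_sum_range hne (fun x hx => (hbib x hx).1) (hmem hy')
      (hmem hy) (hpre hyv') (hpre hyv)) (N + k)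
    simpa using this
  · obtain ⟨e, he, hconv⟩ := convergesUniformlyTo_of_tendsto hne hbib (hmem hy) (hpre hv)
    refine ⟨e, he, fun ε hε => ?_⟩
    obtain ⟨n₀, hn₀⟩ := hconv ε hε
    refine ⟨n₀, fun n hn => ?_⟩
    have := hn₀ (N + n) (by omega)
    beta_reduce at this
    rwa [sum_range_prefix_add N n (fun _ => (0 : X)) y, Finset.sum_const_zero, zero_add] at this

/-- Expansions of a tail extend to the whole sequence when the omitted subspaces are
finite-dimensional. -/
theorem exists_expansion_of_tail {Y : ℕ → Submodule ℝ X} {N : ℕ}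
    (hfin : ∀ k < N, FiniteDimensional ℝ (Y k))
    (hex : ∀ v ∈ (⨆ k, Y (N + k)).topologicalClosure, ∃ y : ℕ → X, (∀ k, y k ∈ Y (N + k)) ∧
      Tendsto (fun n => ∑ k ∈ Finset.range n, y k) atTop (𝓝 v))
    {v : X} (hv : v ∈ (⨆ k, Y k).topologicalClosure) :
    ∃ y : ℕ → X, (∀ k, y k ∈ Y k) ∧
      Tendsto (fun n => ∑ k ∈ Finset.range n, y k) atTop (𝓝 v) := by
  set F : Submodule ℝ X := ⨆ k ∈ Finset.range N, Y k with hF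
  set Z : Submodule ℝ X := (⨆ k, Y (N + k)).topologicalClosure with hZ
  have : FiniteDimensional ℝ F := by
    have (k : Finset.range N) : FiniteDimensional ℝ (Y k) := hfin k (Finset.mem_range.1 k.2)
    rw [hF, iSup_subtype']
    exact Submodule.finiteDimensional_iSup fun k : Finset.range N => Y k
  have hle : ⨆ k, Y k ≤ Z ⊔ F := iSup_le fun k => by
    rcases lt_or_ge k N with h | h
    · exact (le_biSup Y (Finset.mem_range.2 h)).trans le_sup_right
    · obtain ⟨l, rfl⟩ := Nat.exists_eq_add_of_le h
      exact ((le_iSup (fun k => Y (N + k)) l).trans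
        (Submodule.le_topologicalClosure _)).trans le_sup_left
  -- Closedness of `Z ⊔ F` is where finite dimension enters: it splits `v` into a tail vector and a
  -- finite sum.
  have hcl : IsClosed ((Z ⊔ F : Submodule ℝ X) : Set X) :=
    Submodule.isClosed_sup_finiteDimensional Z F (Submodule.isClosed_topologicalClosure _)
  obtain ⟨u, hu, f, hf, rfl⟩ :=
    Submodule.mem_sup.1 (Submodule.topologicalClosure_minimal _ hle hcl hv)
  obtain ⟨z, hz, hzu⟩ := hex u hu
  obtain ⟨g, rfl⟩ := (Submodule.mem_iSup_finset_iff_exists_sum _ _).1 hf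
  refine ⟨_, prefix_mem (f := fun k => (g k : X)) (fun k _ => (g k).2) hz, ?_⟩
  rw [add_comm u]
  exact tendsto_sum_range_prefix N (fun k => (g k : X)) z hzu

end Bidecomposition

theorem theorem3p4 {X : Type*} [NormedAddCommGroup X] [Lattice X] [IsOrderedAddMonoid X]
    [HasSolidNorm X] [NormedSpace ℝ X] [IsOrderedModule ℝ X] [CompleteSpace X]
    (Y : ℕ → Submodule ℝ X)
    (hclosed : ∀ k, IsClosed (Y k : Set X)) (hne : ∀ k, Y k ≠ ⊥)
    (hbib : ∀ x : ℕ → X, (∀ k, x k ∈ Y k ∧ x k ≠ 0) → IsBibasic x) :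
    (∃ N : ℕ, IsBidecomposition (fun k => Y (N + k))) ∧
      ((IsSchauderDecomposition Y ∨ ∀ k, FiniteDimensional ℝ (Y k)) → IsBidecomposition Y) := by
  obtain ⟨N, K, hK, hbound⟩ := exists_tail_norm_sum_range_le hne fun x hx => (hbib x hx).1
  have htail : ∀ v ∈ (⨆ k, Y (N + k)).topologicalClosure, ∃ y : ℕ → X,
      (∀ k, y k ∈ Y (N + k)) ∧
        Tendsto (fun n => ∑ k ∈ Finset.range n, y k) atTop (𝓝 v) := fun v hv =>
    exists_expansion_of_norm_sum_range_le (fun k => hclosed (N + k)) hK hbound hv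
  refine ⟨⟨N, .of_tail_expansion hclosed hne hbib htail⟩, ?_⟩
  rintro (hdec | hfin)
  · exact isBidecomposition_of_exists_expansion hclosed hne hbib fun v hv => (hdec.2 v hv).exists
  · exact isBidecomposition_of_exists_expansion hclosed hne hbib fun v hv =>
      exists_expansion_of_tail (fun k _ => hfin k) htail hv
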